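/- A \emph{drop} is a regular curve $\gamma:[0,1]\to\mathbb{R}^2$ of class $H^2$ (that is, $\partial_x\gamma(x)\neq 0$ for every $x\in[0,1]$) with $\gamma(0)=\gamma(1)$; no condition is imposed on the tangent vectors at the end points. Let $\mathrm{d}s=|\partial_x\gamma|\,\mathrm{d}x$ be the arclength measure, $k$ the scalar curvature of $\gamma$ (defined almost everywhere by $\partial_s^2\gamma=k\nu$, where $\nu$ is the anticlockwise rotation by $\pi/2$ of the unit tangent $\tau=\partial_s\gamma$), $L(\gamma)=\int_\gamma 1\,\mathrm{d}s$ the length, and $$F(\gamma)=\int_\gamma (k^2+1)\,\mathrm{d}s ,\qquad m:=\inf\{F(\gamma)\mid \gamma \text{ is a drop}\}.$$ Then the infimum $m$ is attained: there exists a drop $\gamma$ such that $F(\gamma)=m$. Moreover, every drop $\gamma$ satisfies $\int_\gamma |k|\,\mathrm{d}s\geq\pi$, and for every sequence $(\gamma_n)_{n\in\mathbb{N}}$ of drops with $F(\gamma_n)\to m$ there is a constant $c>0$ such that $L(\gamma_n)\geq c$ for all $n$. -/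

import Mathlib

open Set MeasureTheory Filter Topology
open scoped ContDiff

noncomputable section

namespace ElasticCurve

/-- The Euclidean plane. -/
abbrev Plane : Type := EuclideanSpace ℝ (Fin 2)

/-- `v` is a weak derivative of `u` on the open interval `(0,1)`. -/
def HasWeakDeriv (u v : ℝ → Plane) : Prop :=
  ∀ φ : ℝ → ℝ, ContDiff ℝ ∞ φ → HasCompactSupport φ → tsupport φ ⊆ Ioo (0 : ℝ) 1 →
    ∫ x in Ioo (0 : ℝ) 1, deriv φ x • u x = -∫ x in Ioo (0 : ℝ) 1, φ x • v x

/-- Membership in `L²((0,1); ℝ²)`. -/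
def IsL2 (u : ℝ → Plane) : Prop :=
  MemLp u 2 (volume.restrict (Ioo (0 : ℝ) 1))

/-- `γ : [0,1] → ℝ²` is of class `H²`: it lies in `L²(0,1)` together with its first and second
weak derivatives, and it is the continuous representative of its class on `[0,1]`.
Only the values of `γ` on `[0,1]` matter. -/
def IsH2 (γ : ℝ → Plane) : Prop :=
  ContinuousOn γ (Icc (0 : ℝ) 1) ∧ IsL2 γ ∧
    ∃ u v : ℝ → Plane, IsL2 u ∧ IsL2 v ∧ HasWeakDeriv γ u ∧ HasWeakDeriv u v

/-- The derivative `∂ₓ f` on `[0,1]` (one-sided at the end points). -/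
def dx (f : ℝ → Plane) (x : ℝ) : Plane := derivWithin f (Icc (0 : ℝ) 1) x

/-- The speed `|∂ₓ γ|`. -/
def speed (γ : ℝ → Plane) (x : ℝ) : ℝ := ‖dx γ x‖

/-- The arclength derivative `∂ₛ f = ∂ₓ f / |∂ₓ γ|` along `γ`. -/
def ds (γ f : ℝ → Plane) (x : ℝ) : Plane := (speed γ x)⁻¹ • dx f x

/-- The unit tangent vector `τ = ∂ₛ γ`. -/
def tangent (γ : ℝ → Plane) : ℝ → Plane := ds γ γ

/-- Anticlockwise rotation by `π/2`. -/
def rot (v : Plane) : Plane := !₂[-(v 1), v 0]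

/-- The unit normal vector `ν`. -/
def normal (γ : ℝ → Plane) (x : ℝ) : Plane := rot (tangent γ x)

/-- The scalar curvature `k`, with `∂ₛ² γ = k ν`; for a regular curve of class `H²` it is
determined at almost every `x ∈ [0,1]`. -/
def curvature (γ : ℝ → Plane) (x : ℝ) : ℝ := inner ℝ (ds γ (tangent γ) x) (normal γ x)

/-- `∫_γ f ds = ∫₀¹ f |∂ₓ γ| dx`. -/
def arcIntegral (γ : ℝ → Plane) (f : ℝ → ℝ) : ℝ := ∫ x in (0 : ℝ)..1, f x * speed γ x

/-- The length `L(γ)`. -/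
def length (γ : ℝ → Plane) : ℝ := arcIntegral γ (fun _ => 1)

/-- The penalized elastic energy `F(γ) = ∫_γ (k² + 1) ds`. -/
def energy (γ : ℝ → Plane) : ℝ := arcIntegral γ (fun x => curvature γ x ^ 2 + 1)

/-- `γ` is regular: `∂ₓ γ ≠ 0` everywhere on `[0,1]`. -/
def IsRegular (γ : ℝ → Plane) : Prop := ∀ x ∈ Icc (0 : ℝ) 1, dx γ x ≠ 0

/-- A drop: a regular curve of class `H²` with `γ(0) = γ(1)`. -/
def IsDrop (γ : ℝ → Plane) : Prop := IsH2 γ ∧ IsRegular γ ∧ γ 0 = γ 1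

/-- `m = inf { F(γ) | γ is a drop }`. -/
def infEnergy : ℝ := sInf {e : ℝ | ∃ γ : ℝ → Plane, IsDrop γ ∧ energy γ = e}

end ElasticCurve

end

/-!
The problem is reduced to one about a single real function. The velocity of a regular curve of class
`H²` is absolutely continuous and does not vanish, so it equals `σ (cos Θ, sin Θ)` with a continuous
speed `σ > 0` and an angle `Θ x = θ + ∫₀ˣ κ`, `κ ∈ L²(0,1)`, and the curvature is `k = κ / σ` almost
everywhere (`IsH2.exists_hasPolarVelocity`, `HasPolarVelocity.ae_curvature_eq`). No lifting argument
is needed for `Θ`: in complex notation, if `u = γ'` then `u' / u = ρ + iκ` is integrable and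
`exp (-∫ (ρ + iκ)) u` is constant.

After reparametrization by arclength and rescaling to unit length, a drop of length `ℓ` becomes a
function `g ∈ L²(0,1)` with `∫ cos (∫₀ᵗ g) dt = ∫ sin (∫₀ᵗ g) dt = 0` (`IsClosedCurvature`), and
`∫ |k| ds = ∫ |g|`, `∫ k² ds = ℓ⁻¹ ∫ g²`
(`HasPolarVelocity.exists_isClosedCurvature`). Conversely every such `g` and every `ℓ > 0` come from
a drop (`IsClosedCurvature.exists_isDrop`).

* If `∫ |g| < π`, the angle stays in an interval of length less than `π`, so the tangent has a
  positive component in a fixed direction and the curve cannot close up. Hence `π ≤ ∫ |g|`, and by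
  the Cauchy-Schwarz inequality `π² ≤ ∫ g² = ℓ ∫ k² ds ≤ ℓ F`, which bounds the length of a drop
  from below in terms of its energy.
* For a fixed `g` the energy `ℓ⁻¹ ∫ g² + ℓ` is smallest for `ℓ² = ∫ g²`, with value
  `2 (∫ g²)^(1/2)`, so it remains to minimize `∫ g²`. A minimizing sequence is bounded in `L²` and has a weakly
  convergent subsequence; the angles `∫₀ᵗ g` then converge pointwise, so the limit is admissible by
  dominated convergence, and the norm is weakly lower semicontinuous
  (`exists_isClosedCurvature_minimizing`).
-/

noncomputable section

namespace ElasticCurve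

/-! ### Absolutely continuous functions and weak derivatives of real functions -/

theorem _root_.LipschitzOnWith.comp_absolutelyContinuousOnInterval {F f : ℝ → ℝ} {K : NNReal}
    {s : Set ℝ} {a b : ℝ} (hF : LipschitzOnWith K F s) (hf : AbsolutelyContinuousOnInterval f a b)
    (hm : MapsTo f (uIcc a b) s) : AbsolutelyContinuousOnInterval (fun x => F (f x)) a b := by
  rw [absolutelyContinuousOnInterval_iff] at hf ⊢
  intro ε hε
  obtain ⟨δ, hδ, h⟩ := hf (ε / (K + 1)) (by positivity)
  refine ⟨δ, hδ, fun E hE hE' => ?_⟩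
  calc ∑ i ∈ Finset.range E.1, dist (F (f (E.2 i).1)) (F (f (E.2 i).2))
      ≤ ∑ i ∈ Finset.range E.1, K * dist (f (E.2 i).1) (f (E.2 i).2) := by
        apply Finset.sum_le_sum
        intro i hi
        exact hF.dist_le_mul _ (hm (hE.1 i hi).1) _ (hm (hE.1 i hi).2)
    _ ≤ (K + 1) * ∑ i ∈ Finset.range E.1, dist (f (E.2 i).1) (f (E.2 i).2) := by
        rw [← Finset.mul_sum]
        gcongr
        linarith
    _ < (K + 1) * (ε / (K + 1)) := by
        gcongr
        exact h E hE hE'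
    _ = ε := by field_simp

theorem _root_.ContDiff.comp_absolutelyContinuousOnInterval {F f : ℝ → ℝ} {a b : ℝ}
    (hF : ContDiff ℝ 1 F) (hf : AbsolutelyContinuousOnInterval f a b) :
    AbsolutelyContinuousOnInterval (fun x => F (f x)) a b := by
  obtain ⟨C, hC⟩ := hf.exists_bound
  obtain ⟨K, hK⟩ := (hF.contDiffOn (s := Icc (-C) C)).exists_lipschitzOnWith (by decide)
    (convex_Icc _ _) isCompact_Icc
  exact hK.comp_absolutelyContinuousOnInterval hf fun x hx => abs_le.1 (hC x hx)

theorem absolutelyContinuousOnInterval_const (c a b : ℝ) :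
    AbsolutelyContinuousOnInterval (fun _ => c) a b :=
  (contDiff_const (c := c)).contDiffOn.absolutelyContinuousOnInterval

/-- The primitive of `g` with value `c` at `0`. -/
def primitive (c : ℝ) (g : ℝ → ℝ) (x : ℝ) : ℝ := c + ∫ t in (0 : ℝ)..x, g t

@[simp] theorem primitive_zero (c : ℝ) (g : ℝ → ℝ) : primitive c g 0 = c := by simp [primitive]

theorem absolutelyContinuousOnInterval_primitive {g : ℝ → ℝ} (hg : IntervalIntegrable g volume 0 1)
    (c : ℝ) : AbsolutelyContinuousOnInterval (primitive c g) 0 1 :=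
  (absolutelyContinuousOnInterval_const c 0 1).fun_add
    (hg.absolutelyContinuousOnInterval_intervalIntegral (by simp))

theorem continuousOn_primitive {g : ℝ → ℝ} (hg : IntervalIntegrable g volume 0 1)
    (c : ℝ) : ContinuousOn (primitive c g) (Icc 0 1) := by
  simpa using (absolutelyContinuousOnInterval_primitive hg c).continuousOn

theorem ae_hasDerivAt_primitive {g : ℝ → ℝ} (hg : IntervalIntegrable g volume 0 1) (c : ℝ) :
    ∀ᵐ x, x ∈ Icc (0 : ℝ) 1 → HasDerivAt (primitive c g) (g x) x := by
  filter_upwards [hg.ae_hasDerivAt_integral] with x hx hx'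
  exact (hx (by simpa using hx') 0 (by simp)).const_add c

/-- Smooth functions with compact support in the open interval `(0,1)`. -/
structure IsTest (φ : ℝ → ℝ) : Prop where
  smooth : ContDiff ℝ ∞ φ
  compact : HasCompactSupport φ
  supp : tsupport φ ⊆ Ioo (0 : ℝ) 1

theorem IsTest.eq_zero {φ : ℝ → ℝ} (h : IsTest φ) {x : ℝ} (hx : x ∉ Ioo (0 : ℝ) 1) : φ x = 0 :=
  image_eq_zero_of_notMem_tsupport fun h' => hx (h.supp h')

theorem IsTest.absolutelyContinuousOnInterval {φ : ℝ → ℝ} (h : IsTest φ) :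
    AbsolutelyContinuousOnInterval φ 0 1 :=
  (h.smooth.of_le (by exact_mod_cast le_top)).contDiffOn.absolutelyContinuousOnInterval

/-- A primitive of an integrable function `g` has weak derivative `g`. -/
theorem integral_deriv_test_mul_primitive {g φ : ℝ → ℝ} (hg : IntervalIntegrable g volume 0 1)
    (c : ℝ) (hφ : IsTest φ) :
    ∫ x in (0 : ℝ)..1, deriv φ x * primitive c g x = -∫ x in (0 : ℝ)..1, φ x * g x := by
  have h := hφ.absolutelyContinuousOnInterval.integral_mul_deriv_eq_deriv_mul
    (absolutelyContinuousOnInterval_primitive hg c)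
  rw [hφ.eq_zero (x := 0) (by simp), hφ.eq_zero (x := 1) (by simp)] at h
  have h2 : ∫ x in (0 : ℝ)..1, φ x * deriv (primitive c g) x = ∫ x in (0 : ℝ)..1, φ x * g x := by
    apply intervalIntegral.integral_congr_ae
    filter_upwards [ae_hasDerivAt_primitive hg c] with x hx hx'
    rw [(hx _).deriv]
    rw [uIoc_of_le zero_le_one] at hx'
    exact Ioc_subset_Icc_self hx'
  rw [h2] at h
  linarith

/-- The primitive of a smooth function with vanishing mean and compact support in `(0,1)` is a
test function. -/
theorem exists_isTest_deriv_eq {ψ : ℝ → ℝ} (hψ : IsTest ψ) (h0 : ∫ x in (0 : ℝ)..1, ψ x = 0) :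
    ∃ φ, IsTest φ ∧ deriv φ = ψ := by
  have hc : Continuous ψ := hψ.smooth.continuous
  have hd : ∀ x, HasDerivAt (fun x => ∫ t in (0 : ℝ)..x, ψ t) (ψ x) x := fun x =>
    intervalIntegral.integral_hasDerivAt_right (hc.intervalIntegrable _ _)
      hc.stronglyMeasurable.stronglyMeasurableAtFilter hc.continuousAt
  have hderiv : deriv (fun x => ∫ t in (0 : ℝ)..x, ψ t) = ψ := funext fun x => (hd x).deriv
  obtain ⟨a, b, ha, hb, hab⟩ : ∃ a b : ℝ, 0 < a ∧ b < 1 ∧ tsupport ψ ⊆ Icc a b := by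
    rcases (tsupport ψ).eq_empty_or_nonempty with he | hne
    · exact ⟨1 / 2, 1 / 2, by norm_num, by norm_num, by simp [he]⟩
    · exact ⟨_, _, (hψ.supp (hψ.compact.sInf_mem hne)).1, (hψ.supp (hψ.compact.sSup_mem hne)).2,
        subset_Icc_csInf_csSup hψ.compact.bddBelow hψ.compact.bddAbove⟩
  have hz : ∀ t, t ∉ Icc a b → ψ t = 0 := fun t ht =>
    image_eq_zero_of_notMem_tsupport fun h => ht (hab h)
  have hsupp : Function.support (fun x => ∫ t in (0 : ℝ)..x, ψ t) ⊆ Icc a b := by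
    intro x hx
    by_contra hxn
    apply hx
    rcases lt_or_ge x a with h | h
    · show ∫ t in (0 : ℝ)..x, ψ t = 0
      rw [intervalIntegral.integral_zero_ae]
      refine Eventually.of_forall fun t ht => hz t ?_
      rw [mem_uIoc] at ht
      intro h'
      rcases ht with ht | ht <;> linarith [h'.1]
    · have hbx : b < x := by
        by_contra hh
        exact hxn ⟨h, not_lt.1 hh⟩
      show ∫ t in (0 : ℝ)..x, ψ t = 0
      rw [← intervalIntegral.integral_add_adjacent_intervals (hc.intervalIntegrable 0 1)
        (hc.intervalIntegrable 1 x), h0, zero_add]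
      rw [intervalIntegral.integral_zero_ae]
      refine Eventually.of_forall fun t ht => hz t ?_
      rw [mem_uIoc] at ht
      intro h'
      rcases ht with ht | ht <;> linarith [h'.2]
  have hts : tsupport (fun x => ∫ t in (0 : ℝ)..x, ψ t) ⊆ Icc a b :=
    closure_minimal hsupp isClosed_Icc
  refine ⟨fun x => ∫ t in (0 : ℝ)..x, ψ t, ⟨?_, ?_, ?_⟩, hderiv⟩
  · rw [contDiff_infty_iff_deriv, hderiv]
    exact ⟨fun x => (hd x).differentiableAt, hψ.smooth⟩
  · exact isCompact_Icc.of_isClosed_subset (isClosed_tsupport _) hts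
  · exact hts.trans (Icc_subset_Ioo ha hb)

theorem exists_isTest_integral_eq_one : ∃ χ, IsTest χ ∧ ∫ x in (0 : ℝ)..1, χ x = 1 := by
  let f : ContDiffBump (1 / 2 : ℝ) := ⟨1 / 8, 1 / 4, by norm_num, by norm_num⟩
  have hs : tsupport (f.normed volume) ⊆ Ioo (0 : ℝ) 1 := by
    rw [f.tsupport_normed_eq, Real.closedBall_eq_Icc]
    exact Icc_subset_Ioo (by norm_num [f]) (by norm_num [f])
  refine ⟨f.normed volume, ⟨f.contDiff_normed, f.hasCompactSupport_normed, hs⟩, ?_⟩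
  rw [intervalIntegral.integral_of_le zero_le_one, setIntegral_eq_integral_of_forall_compl_eq_zero,
    f.integral_normed]
  intro x hx
  exact image_eq_zero_of_notMem_tsupport fun h => hx (Ioo_subset_Ioc_self (hs h))

/-- The lemma of du Bois-Reymond. -/
theorem exists_ae_eq_const_of_integral_deriv_test_mul {w : ℝ → ℝ}
    (hw : IntervalIntegrable w volume 0 1)
    (h : ∀ φ, IsTest φ → ∫ x in (0 : ℝ)..1, deriv φ x * w x = 0) :
    ∃ c, ∀ᵐ x, x ∈ Ioo (0 : ℝ) 1 → w x = c := by
  -- `ψ - (∫ ψ) χ` has vanishing mean, hence is the derivative of a test function.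
  obtain ⟨χ, hχ, hχ1⟩ := exists_isTest_integral_eq_one
  set c := ∫ x in (0 : ℝ)..1, χ x * w x with hc
  refine ⟨c, ?_⟩
  have hint : ∀ ψ, IsTest ψ → IntervalIntegrable (fun x => ψ x * w x) volume 0 1 := fun ψ hψ =>
    hw.continuousOn_mul hψ.smooth.continuous.continuousOn
  have hw' : IntegrableOn (fun x => w x - c) (Ioo (0 : ℝ) 1) := by
    rw [← intervalIntegrable_iff_integrableOn_Ioo_of_le zero_le_one]
    exact hw.sub intervalIntegrable_const
  have := isOpen_Ioo.ae_eq_zero_of_integral_contDiff_smul_eq_zero (μ := volume)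
    hw'.locallyIntegrableOn (fun ψ h1 h2 h3 => ?_)
  · filter_upwards [this] with x hx hx'
    linarith [hx hx']
  · have hψ : IsTest ψ := ⟨h1, h2, h3⟩
    set d := ∫ x in (0 : ℝ)..1, ψ x with hd
    have hci : ∀ ψ, IsTest ψ → IntervalIntegrable ψ volume 0 1 := fun ψ hψ =>
      hψ.smooth.continuous.intervalIntegrable _ _
    have hη : IsTest (fun x => ψ x - d * χ x) := by
      refine ⟨h1.sub (contDiff_const.mul hχ.smooth), h2.sub (hχ.compact.mul_left), ?_⟩
      refine (tsupport_sub _ _).trans (union_subset h3 ?_)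
      exact (tsupport_mul_subset_right).trans hχ.supp
    obtain ⟨φ, hφ, hφd⟩ := exists_isTest_deriv_eq hη (by
      rw [intervalIntegral.integral_sub (hci _ hψ) ((hci _ hχ).const_mul d),
        intervalIntegral.integral_const_mul, hχ1, mul_one, sub_self])
    have h4 := h φ hφ
    rw [hφd] at h4
    have h5 : ∫ x in (0 : ℝ)..1, ψ x * w x = d * c := by
      have : ∀ x, (ψ x - d * χ x) * w x = ψ x * w x - d * (χ x * w x) := fun x => by ring
      simp_rw [this] at h4
      rw [intervalIntegral.integral_sub (hint _ hψ) ((hint _ hχ).const_mul d),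
        intervalIntegral.integral_const_mul] at h4
      linarith
    have h6 : ∫ x in (0 : ℝ)..1, ψ x * (w x - c) = 0 := by
      have : ∀ x, ψ x * (w x - c) = ψ x * w x - ψ x * c := fun x => by ring
      simp_rw [this]
      rw [intervalIntegral.integral_sub (hint _ hψ) ((hci _ hψ).mul_const c),
        intervalIntegral.integral_mul_const, h5, ← hd]
      ring
    rw [intervalIntegral.integral_of_le zero_le_one,
      setIntegral_eq_integral_of_forall_compl_eq_zero] at h6
    · simpa using h6
    · intro x hx
      rw [hψ.eq_zero (fun h => hx (Ioo_subset_Ioc_self h)), zero_mul]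

/-- A function with integrable weak derivative `g` on `(0,1)` is a primitive of `g`, up to a null
set. -/
theorem exists_ae_eq_primitive {f g : ℝ → ℝ} (hf : IntervalIntegrable f volume 0 1)
    (hg : IntervalIntegrable g volume 0 1)
    (h : ∀ φ, IsTest φ →
      ∫ x in (0 : ℝ)..1, deriv φ x * f x = -∫ x in (0 : ℝ)..1, φ x * g x) :
    ∃ c, ∀ᵐ x, x ∈ Ioo (0 : ℝ) 1 → f x = primitive c g x := by
  have hp : IntervalIntegrable (primitive 0 g) volume 0 1 := by
    apply ContinuousOn.intervalIntegrable
    simpa using continuousOn_primitive hg 0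
  obtain ⟨c, hc⟩ := exists_ae_eq_const_of_integral_deriv_test_mul
    (w := fun x => f x - primitive 0 g x)
    (hf.sub hp) (fun φ hφ => by
      have hcd : Continuous (deriv φ) := hφ.smooth.continuous_deriv (by simp)
      simp_rw [mul_sub]
      rw [intervalIntegral.integral_sub (hf.continuousOn_mul hcd.continuousOn)
        (hp.continuousOn_mul hcd.continuousOn), h φ hφ, integral_deriv_test_mul_primitive hg 0 hφ,
        sub_self])
  refine ⟨c, ?_⟩
  filter_upwards [hc] with x hx hx'
  have := hx hx'
  simp only [primitive, zero_add] at this ⊢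
  linarith

/-! ### Plane curves of class `H²` -/

/-- Membership of a real function in `L²(0,1)`. -/
def RealL2 (g : ℝ → ℝ) : Prop := MemLp g 2 (volume.restrict (Ioo (0 : ℝ) 1))

theorem isL2_iff {u : ℝ → Plane} : IsL2 u ↔ ∀ i, RealL2 (fun x => u x i) := memLp_piLp_iff

theorem RealL2.intervalIntegrable {g : ℝ → ℝ} (h : RealL2 g) : IntervalIntegrable g volume 0 1 := by
  rw [intervalIntegrable_iff_integrableOn_Ioo_of_le zero_le_one]
  exact MemLp.integrable one_le_two h

theorem _root_.ContinuousOn.intervalIntegrable_unit {f : ℝ → ℝ} (hf : ContinuousOn f (Icc 0 1)) :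
    IntervalIntegrable f volume 0 1 :=
  ContinuousOn.intervalIntegrable (by simpa only [uIcc_of_le zero_le_one] using hf)

theorem integral_Ioo_eq (f : ℝ → ℝ) :
    ∫ x in Ioo (0 : ℝ) 1, f x = ∫ x in (0 : ℝ)..1, f x := by
  rw [intervalIntegral.integral_of_le zero_le_one, integral_Ioc_eq_integral_Ioo]

theorem _root_.ContinuousOn.realL2 {f : ℝ → ℝ} (hf : ContinuousOn f (Icc 0 1)) : RealL2 f := by
  obtain ⟨C, hC⟩ := isCompact_Icc.exists_bound_of_continuousOn hf
  refine MemLp.of_bound ((hf.mono Ioo_subset_Icc_self).aestronglyMeasurable measurableSet_Ioo) C ?_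
  filter_upwards [self_mem_ae_restrict measurableSet_Ioo] with x hx
  exact hC x (Ioo_subset_Icc_self hx)

theorem RealL2.continuousOn_mul {f g : ℝ → ℝ} (hg : RealL2 g) (hf : ContinuousOn f (Icc 0 1)) :
    RealL2 (fun x => f x * g x) := by
  obtain ⟨C, hC⟩ := isCompact_Icc.exists_bound_of_continuousOn hf
  refine MemLp.mul' (p := ⊤) (q := 2) hg
    (memLp_top_of_bound ((hf.mono Ioo_subset_Icc_self).aestronglyMeasurable measurableSet_Ioo) C ?_)
  filter_upwards [self_mem_ae_restrict measurableSet_Ioo] with x hx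
  exact hC x (Ioo_subset_Icc_self hx)

theorem RealL2.intervalIntegrable_mul {f g : ℝ → ℝ} (hf : RealL2 f)
    (hg : RealL2 g) : IntervalIntegrable (fun x => f x * g x) volume 0 1 := by
  rw [intervalIntegrable_iff_integrableOn_Ioo_of_le zero_le_one]
  exact MemLp.integrable_mul hf hg

/-- Weak derivatives may be taken componentwise. -/
theorem hasWeakDeriv_iff {u v : ℝ → Plane} (hu : IsL2 u) (hv : IsL2 v) :
    HasWeakDeriv u v ↔ ∀ i, ∀ φ, IsTest φ →
      ∫ x in (0 : ℝ)..1, deriv φ x * u x i = -∫ x in (0 : ℝ)..1, φ x * v x i := by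
  have key : ∀ φ : ℝ → ℝ, IsTest φ →
      ((∫ x in Ioo (0 : ℝ) 1, deriv φ x • u x = -∫ x in Ioo (0 : ℝ) 1, φ x • v x) ↔
      ∀ i, ∫ x in (0 : ℝ)..1, deriv φ x * u x i = -∫ x in (0 : ℝ)..1, φ x * v x i) := by
    intro φ hφ
    have hint : ∀ (w : ℝ → Plane) (χ : ℝ → ℝ), IsL2 w → Continuous χ → ∀ i,
        Integrable (fun x => (χ x • w x) i) (volume.restrict (Ioo (0 : ℝ) 1)) := fun w χ hw hχ i =>
      MemLp.integrable one_le_two ((isL2_iff.1 hw i).continuousOn_mul hχ.continuousOn)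
    have e : ∀ (w : ℝ → Plane) (χ : ℝ → ℝ), IsL2 w → Continuous χ → ∀ i,
        (∫ x in Ioo (0 : ℝ) 1, χ x • w x) i = ∫ x in (0 : ℝ)..1, χ x * w x i := by
      intro w χ hw hχ i
      rw [eval_integral_piLp (hint w χ hw hχ), integral_Ioo_eq]
      rfl
    have hcd : Continuous (deriv φ) := hφ.smooth.continuous_deriv (by simp)
    constructor
    · intro h i
      rw [← e u _ hu hcd, ← e v _ hv hφ.smooth.continuous, h]
      rfl
    · intro h
      ext i
      rw [e u _ hu hcd, h i, PiLp.neg_apply, e v _ hv hφ.smooth.continuous]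
  constructor
  · intro h i φ hφ
    exact (key φ hφ).1 (h φ hφ.smooth hφ.compact hφ.supp) i
  · intro h φ h1 h2 h3
    exact (key φ ⟨h1, h2, h3⟩).2 fun i => h i φ ⟨h1, h2, h3⟩

theorem primitive_congr {f g : ℝ → ℝ} (h : ∀ᵐ x, x ∈ Ioo (0 : ℝ) 1 → f x = g x) (c : ℝ) {x : ℝ}
    (hx : x ∈ Icc (0 : ℝ) 1) : primitive c f x = primitive c g x := by
  unfold primitive
  congr 1
  apply intervalIntegral.integral_congr_ae
  have h1 : ∀ᵐ t : ℝ, t ≠ 1 := by simp [ae_iff, measure_singleton]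
  filter_upwards [h, h1] with t ht h1 ht'
  rw [uIoc_of_le hx.1] at ht'
  exact ht ⟨ht'.1, lt_of_le_of_ne (ht'.2.trans hx.2) h1⟩

theorem hasDerivWithinAt_primitive {g : ℝ → ℝ} (hg : ContinuousOn g (Icc 0 1)) (c : ℝ) {x : ℝ}
    (hx : x ∈ Icc (0 : ℝ) 1) : HasDerivWithinAt (primitive c g) (g x) (Icc 0 1) x := by
  have : Fact (x ∈ Icc (0 : ℝ) 1) := ⟨hx⟩
  refine HasDerivWithinAt.const_add c
    (intervalIntegral.integral_hasDerivWithinAt_right ?_ ?_ (hg x hx))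
  · exact (hg.mono (by rw [uIcc_of_le hx.1]; exact Icc_subset_Icc_right hx.2)).intervalIntegrable
  · exact hg.stronglyMeasurableAtFilter_nhdsWithin measurableSet_Icc x

theorem eq_primitive_of_hasDerivWithinAt {f g : ℝ → ℝ} (hg : ContinuousOn g (Icc 0 1))
    (h : ∀ x ∈ Icc (0 : ℝ) 1, HasDerivWithinAt f (g x) (Icc 0 1) x) {x : ℝ}
    (hx : x ∈ Icc (0 : ℝ) 1) : f x = primitive (f 0) g x := by
  have hs : Icc 0 x ⊆ Icc (0 : ℝ) 1 := Icc_subset_Icc_right hx.2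
  have := intervalIntegral.integral_eq_sub_of_hasDerivAt_of_le hx.1
    (fun y hy => ((h y (hs hy)).continuousWithinAt.mono hs))
    (fun y hy => (h y (hs (Ioo_subset_Icc_self hy))).hasDerivAt
      (Icc_mem_nhds hy.1 (hy.2.trans_le hx.2)))
    ((hg.mono (by rw [uIcc_of_le hx.1]; exact hs)).intervalIntegrable)
  rw [primitive, this]
  ring

theorem hasDerivWithinAt_plane {f : ℝ → Plane} {f' : Plane} {s : Set ℝ} {x : ℝ} :
    HasDerivWithinAt f f' s x ↔ ∀ i, HasDerivWithinAt (fun y => f y i) (f' i) s x := by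
  simp only [hasDerivWithinAt_iff_hasFDerivWithinAt, hasFDerivWithinAt_euclidean]
  refine forall_congr' fun i => ?_
  apply iff_of_eq
  congr 1

/-- A weakly differentiable continuous real function with continuous weak derivative is
classically differentiable up to the end points. -/
theorem hasDerivWithinAt_of_ae_eq_primitive {f g : ℝ → ℝ} {c : ℝ} (hf : ContinuousOn f (Icc 0 1))
    (hg : ContinuousOn g (Icc 0 1)) (h : ∀ᵐ x, x ∈ Ioo (0 : ℝ) 1 → f x = primitive c g x)
    {x : ℝ} (hx : x ∈ Icc (0 : ℝ) 1) : HasDerivWithinAt f (g x) (Icc 0 1) x := by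
  have e : EqOn f (primitive c g) (Icc 0 1) := by
    refine Measure.eqOn_Icc_of_ae_eq volume zero_ne_one ?_ hf
      (fun y hy => (hasDerivWithinAt_primitive hg c hy).continuousWithinAt)
    rw [Filter.EventuallyEq, ← Measure.restrict_congr_set Ioo_ae_eq_Icc,
      ae_restrict_iff' measurableSet_Ioo]
    exact h
  exact (hasDerivWithinAt_primitive hg c hx).congr e (e hx)

/-- The embedding of `H²` into `C¹`: the derivative of a curve of class `H²` exists everywhere on
`[0,1]` and is a primitive of a square integrable function. -/
theorem IsH2.exists_hasDerivWithinAt {γ : ℝ → Plane} (h : IsH2 γ) :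
    ∃ (c : Fin 2 → ℝ) (p : Fin 2 → ℝ → ℝ), (∀ i, RealL2 (p i)) ∧
      ∀ x ∈ Icc (0 : ℝ) 1, ∀ i,
        HasDerivWithinAt (fun y => γ y i) (primitive (c i) (p i) x) (Icc 0 1) x := by
  obtain ⟨hc, hL, u, v, hu, hv, hγu, huv⟩ := h
  rw [hasWeakDeriv_iff hL hu] at hγu
  rw [hasWeakDeriv_iff hu hv] at huv
  have hu' := isL2_iff.1 hu
  have hv' := isL2_iff.1 hv
  have h1 := fun i => exists_ae_eq_primitive (hu' i).intervalIntegrable (hv' i).intervalIntegrable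
    (huv i)
  choose c hc1 using h1
  refine ⟨c, fun i x => v x i, hv', fun x hx i => ?_⟩
  obtain ⟨d, hd⟩ := exists_ae_eq_primitive (isL2_iff.1 hL i).intervalIntegrable
    (hu' i).intervalIntegrable (hγu i)
  have hci : ContinuousOn (fun y => γ y i) (Icc 0 1) :=
    (EuclideanSpace.proj (𝕜 := ℝ) i).continuous.comp_continuousOn hc
  refine hasDerivWithinAt_of_ae_eq_primitive (c := d) hci
    (continuousOn_primitive (hv' i).intervalIntegrable _) ?_ hx
  filter_upwards [hd] with y hy hy'
  rw [hy hy']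
  exact primitive_congr (hc1 i) d (Ioo_subset_Icc_self hy')

/-- Converse of `IsH2.exists_hasDerivWithinAt`: a curve whose derivative is a primitive of a square
integrable function is of class `H²`. -/
theorem isH2_of_hasDerivWithinAt {γ : ℝ → Plane} {c : Fin 2 → ℝ} {p : Fin 2 → ℝ → ℝ}
    (hp : ∀ i, RealL2 (p i)) (h : ∀ x ∈ Icc (0 : ℝ) 1, ∀ i,
        HasDerivWithinAt (fun y => γ y i) (primitive (c i) (p i) x) (Icc 0 1) x) : IsH2 γ := by
  have hci : ∀ i, ContinuousOn (fun y => γ y i) (Icc 0 1) :=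
    fun i y hy => (h y hy i).continuousWithinAt
  have hpi : ∀ i, ContinuousOn (primitive (c i) (p i)) (Icc 0 1) :=
    fun i => continuousOn_primitive (hp i).intervalIntegrable _
  have hγL : IsL2 γ := isL2_iff.2 fun i => (hci i).realL2
  have hu : IsL2 (fun x => WithLp.toLp 2 fun i => primitive (c i) (p i) x) :=
    isL2_iff.2 fun i => (hpi i).realL2
  have hv : IsL2 (fun x => WithLp.toLp 2 fun i => p i x) := isL2_iff.2 hp
  refine ⟨fun y hy => ((hasDerivWithinAt_plane (f' := WithLp.toLp 2 fun i =>
    primitive (c i) (p i) y)).2 fun i => h y hy i).continuousWithinAt, hγL,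
    fun x => WithLp.toLp 2 fun i => primitive (c i) (p i) x,
    fun x => WithLp.toLp 2 fun i => p i x, hu, hv, ?_, ?_⟩
  · rw [hasWeakDeriv_iff hγL hu]
    intro i φ hφ
    rw [← integral_deriv_test_mul_primitive (hpi i).realL2.intervalIntegrable (γ 0 i) hφ]
    apply intervalIntegral.integral_congr
    intro x hx
    rw [uIcc_of_le zero_le_one] at hx
    simp only
    rw [eq_primitive_of_hasDerivWithinAt (hpi i) (fun x hx => h x hx i) hx]
  · rw [hasWeakDeriv_iff hu hv]
    intro i φ hφ
    exact integral_deriv_test_mul_primitive (hp i).intervalIntegrable (c i) hφ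

/-! ### Polar coordinates for the velocity -/

/-- An absolutely continuous function on `[0,1]` with almost everywhere vanishing derivative is
constant. -/
theorem eq_of_ae_hasDerivAt_zero {f : ℝ → ℝ} (hf : AbsolutelyContinuousOnInterval f 0 1)
    (h : ∀ᵐ x, x ∈ Icc (0 : ℝ) 1 → HasDerivAt f 0 x) {x : ℝ} (hx : x ∈ Icc (0 : ℝ) 1) :
    f x = f 0 := by
  obtain ⟨C, hC⟩ := hf.const_of_ae_hasDerivAt_zero (by simpa using h)
  simp only [zero_le_one, uIcc_of_le] at hC
  rw [hC x hx, hC 0 (by simp)]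

/-- Polar coordinates for a nonvanishing planar vector field whose components `a`, `b` are
primitives of square integrable functions: the angle is again a primitive of a square integrable
function. -/
theorem exists_polar {p q : ℝ → ℝ} (hp : RealL2 p) (hq : RealL2 q) (a₀ b₀ : ℝ)
    (hne : ∀ x ∈ Icc (0 : ℝ) 1, primitive a₀ p x ≠ 0 ∨ primitive b₀ q x ≠ 0) :
    ∃ (σ κ : ℝ → ℝ) (θ : ℝ), ContinuousOn σ (Icc 0 1) ∧ (∀ x, 0 < σ x) ∧ RealL2 κ ∧
      ∀ x ∈ Icc (0 : ℝ) 1, primitive a₀ p x = σ x * Real.cos (primitive θ κ x) ∧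
        primitive b₀ q x = σ x * Real.sin (primitive θ κ x) := by
  set a := primitive a₀ p with ha
  set b := primitive b₀ q with hb
  have hac : ContinuousOn a (Icc 0 1) := continuousOn_primitive hp.intervalIntegrable _
  have hbc : ContinuousOn b (Icc 0 1) := continuousOn_primitive hq.intervalIntegrable _
  have hpos : ∀ x ∈ Icc (0 : ℝ) 1, 0 < a x ^ 2 + b x ^ 2 := by
    intro x hx
    rcases hne x hx with h | h <;> positivity
  have hnc : ContinuousOn (fun x => (a x ^ 2 + b x ^ 2)⁻¹) (Icc 0 1) :=
    ((hac.pow 2).add (hbc.pow 2)).inv₀ fun x hx => (hpos x hx).ne'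
  -- In complex notation `v/u = ρ + iκ` is the logarithmic derivative of `u = a + ib`, `v = p + iq`.
  set κ : ℝ → ℝ := fun x => (a x ^ 2 + b x ^ 2)⁻¹ * a x * q x - (a x ^ 2 + b x ^ 2)⁻¹ * b x * p x
    with hκ
  set ρ : ℝ → ℝ := fun x => (a x ^ 2 + b x ^ 2)⁻¹ * a x * p x + (a x ^ 2 + b x ^ 2)⁻¹ * b x * q x
    with hρ
  have hκL : RealL2 κ := (hq.continuousOn_mul (hnc.mul hac)).sub (hp.continuousOn_mul (hnc.mul hbc))
  have hρL : RealL2 ρ := (hp.continuousOn_mul (hnc.mul hac)).add (hq.continuousOn_mul (hnc.mul hbc))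
  set R := primitive 0 ρ with hR
  set Θ := primitive 0 κ with hΘ
  have hAa : AbsolutelyContinuousOnInterval a 0 1 :=
    absolutelyContinuousOnInterval_primitive hp.intervalIntegrable _
  have hAb : AbsolutelyContinuousOnInterval b 0 1 :=
    absolutelyContinuousOnInterval_primitive hq.intervalIntegrable _
  have hAR : AbsolutelyContinuousOnInterval R 0 1 :=
    absolutelyContinuousOnInterval_primitive hρL.intervalIntegrable _
  have hAΘ : AbsolutelyContinuousOnInterval Θ 0 1 :=
    absolutelyContinuousOnInterval_primitive hκL.intervalIntegrable _
  have hAe : AbsolutelyContinuousOnInterval (fun x => Real.exp (-R x)) 0 1 :=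
    (Real.contDiff_exp.comp contDiff_neg).comp_absolutelyContinuousOnInterval hAR
  have hAc := Real.contDiff_cos.comp_absolutelyContinuousOnInterval hAΘ
  have hAs := Real.contDiff_sin.comp_absolutelyContinuousOnInterval hAΘ
  have hder := ae_hasDerivAt_primitive hp.intervalIntegrable a₀
  have hder2 := ae_hasDerivAt_primitive hq.intervalIntegrable b₀
  have hder3 := ae_hasDerivAt_primitive hρL.intervalIntegrable 0
  have hder4 := ae_hasDerivAt_primitive hκL.intervalIntegrable 0
  -- the real and imaginary parts of the constant function `exp (-(R + iΘ)) u`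
  have hP : ∀ x ∈ Icc (0 : ℝ) 1,
      Real.exp (-R x) * (a x * Real.cos (Θ x) + b x * Real.sin (Θ x)) = a₀ := by
    intro x hx
    have := eq_of_ae_hasDerivAt_zero (f := fun x =>
      Real.exp (-R x) * (a x * Real.cos (Θ x) + b x * Real.sin (Θ x)))
      (hAe.fun_mul ((hAa.fun_mul hAc).fun_add (hAb.fun_mul hAs))) (by
        filter_upwards [hder, hder2, hder3, hder4] with y h1 h2 h3 h4 hy
        have h5 := (h3 hy).neg.exp.mul (((h1 hy).mul (h4 hy).cos).add ((h2 hy).mul (h4 hy).sin))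
        refine h5.congr_deriv ?_
        have hn := (hpos y hy).ne'
        simp only [hρ, hκ, ← ha, ← hb, Pi.neg_apply, Pi.mul_apply, Pi.add_apply]
        field_simp
        ring) hx
    simpa [ha, hb, hR, hΘ] using this
  have hQ : ∀ x ∈ Icc (0 : ℝ) 1,
      Real.exp (-R x) * (b x * Real.cos (Θ x) - a x * Real.sin (Θ x)) = b₀ := by
    intro x hx
    have := eq_of_ae_hasDerivAt_zero (f := fun x =>
      Real.exp (-R x) * (b x * Real.cos (Θ x) - a x * Real.sin (Θ x)))
      (hAe.fun_mul ((hAb.fun_mul hAc).fun_sub (hAa.fun_mul hAs))) (by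
        filter_upwards [hder, hder2, hder3, hder4] with y h1 h2 h3 h4 hy
        have h5 := (h3 hy).neg.exp.mul (((h2 hy).mul (h4 hy).cos).sub ((h1 hy).mul (h4 hy).sin))
        refine h5.congr_deriv ?_
        have hn := (hpos y hy).ne'
        simp only [hρ, hκ, ← ha, ← hb, Pi.neg_apply, Pi.mul_apply, Pi.sub_apply]
        field_simp
        ring) hx
    simpa [ha, hb, hR, hΘ] using this
  -- polar coordinates of the initial value
  set z : ℂ := ⟨a₀, b₀⟩ with hz
  have hz0 : 0 < ‖z‖ := by
    rw [norm_pos_iff]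
    intro h0
    have := hpos 0 (by simp)
    simp only [ha, hb, primitive_zero] at this
    have h1 : a₀ = 0 := congrArg Complex.re h0
    have h2 : b₀ = 0 := congrArg Complex.im h0
    simp [h1, h2] at this
  have hza : a₀ = ‖z‖ * Real.cos z.arg := by rw [Complex.norm_mul_cos_arg]
  have hzb : b₀ = ‖z‖ * Real.sin z.arg := by rw [Complex.norm_mul_sin_arg]
  refine ⟨fun x => Real.exp (R x) * ‖z‖, κ, z.arg, ?_, fun x => by positivity, hκL, ?_⟩
  · have hRc : ContinuousOn R (Icc 0 1) := continuousOn_primitive hρL.intervalIntegrable _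
    exact (Real.continuous_exp.comp_continuousOn hRc).mul continuousOn_const
  · intro x hx
    have e1 := hP x hx
    have e2 := hQ x hx
    have hth : primitive z.arg κ x = z.arg + Θ x := by simp [hΘ, primitive]
    have hexp : Real.exp (R x) * Real.exp (-R x) = 1 := by rw [← Real.exp_add]; simp
    have hcs := Real.sin_sq_add_cos_sq (Θ x)
    rw [hth, Real.cos_add, Real.sin_add]
    constructor
    · have : Real.exp (R x) * ‖z‖ *
          (Real.cos z.arg * Real.cos (Θ x) - Real.sin z.arg * Real.sin (Θ x))
        = Real.exp (R x) * (a₀ * Real.cos (Θ x) - b₀ * Real.sin (Θ x)) := by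
        rw [hza, hzb]; ring
      rw [this, ← e1, ← e2]
      linear_combination (-(a x) * (Real.cos (Θ x) ^ 2 + Real.sin (Θ x) ^ 2)) * hexp - a x * hcs
    · have : Real.exp (R x) * ‖z‖ *
          (Real.sin z.arg * Real.cos (Θ x) + Real.cos z.arg * Real.sin (Θ x))
        = Real.exp (R x) * (b₀ * Real.cos (Θ x) + a₀ * Real.sin (Θ x)) := by
        rw [hza, hzb]; ring
      rw [this, ← e1, ← e2]
      linear_combination (-(b x) * (Real.cos (Θ x) ^ 2 + Real.sin (Θ x) ^ 2)) * hexp - b x * hcs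

/-- The unit vector with angle `θ`. -/
def cis (θ : ℝ) : Plane := !₂[Real.cos θ, Real.sin θ]

/-- The curve `η` has speed `σ` and tangent angle `Θ x = θ + ∫₀ˣ κ`, where `σ` is continuous and
positive and `κ` is square integrable on `(0,1)`. Positivity is asked for on the whole line for
convenience; the values of `σ` off `[0,1]` play no role. -/
structure HasPolarVelocity (η : ℝ → Plane) (σ κ : ℝ → ℝ) (θ : ℝ) : Prop where
  continuousOn : ContinuousOn σ (Icc 0 1)
  pos : ∀ x, 0 < σ x
  realL2 : RealL2 κ
  hasDerivWithinAt : ∀ x ∈ Icc (0 : ℝ) 1,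
    HasDerivWithinAt η (σ x • cis (primitive θ κ x)) (Icc 0 1) x

theorem IsH2.exists_hasPolarVelocity {η : ℝ → Plane} (h : IsH2 η) (hr : IsRegular η) :
    ∃ σ κ θ, HasPolarVelocity η σ κ θ := by
  obtain ⟨c, p, hp, hd⟩ := h.exists_hasDerivWithinAt
  obtain ⟨σ, κ, θ, h1, h2, h3, h4⟩ := exists_polar (hp 0) (hp 1) (c 0) (c 1) (by
    intro x hx
    by_contra hcon
    push Not at hcon
    apply hr x hx
    have : HasDerivWithinAt η 0 (Icc 0 1) x := by
      rw [hasDerivWithinAt_plane]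
      intro i
      have := hd x hx i
      fin_cases i
      · simpa [hcon.1] using this
      · simpa [hcon.2] using this
    exact this.derivWithin (uniqueDiffOn_Icc zero_lt_one x hx))
  refine ⟨σ, κ, θ, h1, h2, h3, fun x hx => ?_⟩
  rw [hasDerivWithinAt_plane]
  intro i
  have := hd x hx i
  fin_cases i
  · simpa [cis, (h4 x hx).1] using this
  · simpa [cis, (h4 x hx).2] using this

/-! ### Curvature, length and energy in polar coordinates -/

theorem norm_cis (θ : ℝ) : ‖cis θ‖ = 1 := by
  simp [cis, EuclideanSpace.norm_eq]

theorem inner_rot_cis_self (θ : ℝ) : inner ℝ (rot (cis θ)) (rot (cis θ)) = 1 := by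
  simp [cis, rot, EuclideanSpace.norm_eq]

theorem _root_.HasDerivWithinAt.cis {f : ℝ → ℝ} {f' x : ℝ} {s : Set ℝ}
    (h : HasDerivWithinAt f f' s x) :
    HasDerivWithinAt (fun y => cis (f y)) (f' • rot (cis (f x))) s x := by
  rw [hasDerivWithinAt_plane]
  intro i
  fin_cases i
  · simpa [ElasticCurve.cis, rot, mul_comm] using h.cos
  · simpa [ElasticCurve.cis, rot, mul_comm] using h.sin

namespace HasPolarVelocity

variable {η : ℝ → Plane} {σ κ : ℝ → ℝ} {θ : ℝ}

theorem dx_eq (h : HasPolarVelocity η σ κ θ) {x : ℝ} (hx : x ∈ Icc (0 : ℝ) 1) :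
    dx η x = σ x • cis (primitive θ κ x) :=
  (h.hasDerivWithinAt x hx).derivWithin (uniqueDiffOn_Icc zero_lt_one x hx)

theorem speed_eq (h : HasPolarVelocity η σ κ θ) {x : ℝ} (hx : x ∈ Icc (0 : ℝ) 1) :
    speed η x = σ x := by
  rw [speed, h.dx_eq hx, norm_smul, norm_cis, mul_one, Real.norm_of_nonneg (h.pos x).le]

theorem tangent_eq (h : HasPolarVelocity η σ κ θ) {x : ℝ} (hx : x ∈ Icc (0 : ℝ) 1) :
    tangent η x = cis (primitive θ κ x) := by
  rw [tangent, ds, h.speed_eq hx, h.dx_eq hx, inv_smul_smul₀ (h.pos x).ne']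

theorem isRegular (h : HasPolarVelocity η σ κ θ) : IsRegular η := by
  intro x hx h0
  have := h.speed_eq hx
  rw [speed, h0, norm_zero] at this
  exact (h.pos x).ne this

/-- The tangent angle has arclength derivative `k`. -/
theorem ae_curvature_eq (h : HasPolarVelocity η σ κ θ) :
    ∀ᵐ x, x ∈ Icc (0 : ℝ) 1 → curvature η x = κ x / σ x := by
  filter_upwards [ae_hasDerivAt_primitive h.realL2.intervalIntegrable θ] with x hx hxI
  have h1 : HasDerivWithinAt (tangent η) (κ x • rot (cis (primitive θ κ x))) (Icc 0 1) x :=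
    (hx hxI).hasDerivWithinAt.cis.congr (fun y hy => h.tangent_eq hy) (h.tangent_eq hxI)
  rw [curvature, ds, dx, h1.derivWithin (uniqueDiffOn_Icc zero_lt_one x hxI), normal,
    h.tangent_eq hxI, h.speed_eq hxI, real_inner_smul_left, real_inner_smul_left,
    inner_rot_cis_self]
  field_simp

theorem arcIntegral_curvature (h : HasPolarVelocity η σ κ θ) (Φ : ℝ → ℝ) :
    arcIntegral η (fun x => Φ (curvature η x)) = ∫ x in (0 : ℝ)..1, Φ (κ x / σ x) * σ x := by
  apply intervalIntegral.integral_congr_ae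
  filter_upwards [h.ae_curvature_eq] with x hx hxI
  rw [uIoc_of_le zero_le_one] at hxI
  have hx' := Ioc_subset_Icc_self hxI
  rw [hx hx', h.speed_eq hx']

theorem length_eq (h : HasPolarVelocity η σ κ θ) : length η = ∫ x in (0 : ℝ)..1, σ x := by
  rw [length, h.arcIntegral_curvature (fun _ => 1)]
  simp

theorem continuousOn_angle (h : HasPolarVelocity η σ κ θ) :
    ContinuousOn (primitive θ κ) (Icc 0 1) :=
  continuousOn_primitive h.realL2.intervalIntegrable θ

theorem realL2_inv_mul (h : HasPolarVelocity η σ κ θ) : RealL2 (fun x => (σ x)⁻¹ * κ x) :=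
  h.realL2.continuousOn_mul (h.continuousOn.inv₀ fun x _ => (h.pos x).ne')

theorem intervalIntegrable_sq_div (h : HasPolarVelocity η σ κ θ) :
    IntervalIntegrable (fun x => κ x ^ 2 / σ x) volume 0 1 :=
  (h.realL2_inv_mul.intervalIntegrable_mul h.realL2).congr
    (fun x _ => by rw [div_eq_mul_inv]; ring)

theorem intervalIntegrable_speed (h : HasPolarVelocity η σ κ θ) :
    IntervalIntegrable σ volume 0 1 :=
  h.continuousOn.intervalIntegrable_unit

theorem energy_eq (h : HasPolarVelocity η σ κ θ) :
    energy η = (∫ x in (0 : ℝ)..1, κ x ^ 2 / σ x) + ∫ x in (0 : ℝ)..1, σ x := by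
  rw [energy, h.arcIntegral_curvature (fun k => k ^ 2 + 1),
    ← intervalIntegral.integral_add h.intervalIntegrable_sq_div h.intervalIntegrable_speed]
  congr 1
  ext x
  have := (h.pos x).ne'
  field_simp

theorem arcIntegral_abs_curvature (h : HasPolarVelocity η σ κ θ) :
    arcIntegral η (fun x => |curvature η x|) = ∫ x in (0 : ℝ)..1, |κ x| := by
  rw [h.arcIntegral_curvature (fun k => |k|)]
  congr 1
  ext x
  rw [abs_div, abs_of_pos (h.pos x), div_mul_cancel₀ _ (h.pos x).ne']

theorem eq_add_integral (h : HasPolarVelocity η σ κ θ) {x : ℝ} (hx : x ∈ Icc (0 : ℝ) 1) :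
    η x 0 = η 0 0 + ∫ t in (0 : ℝ)..x, σ t * Real.cos (primitive θ κ t) ∧
      η x 1 = η 0 1 + ∫ t in (0 : ℝ)..x, σ t * Real.sin (primitive θ κ t) := by
  constructor
  · exact eq_primitive_of_hasDerivWithinAt
      (h.continuousOn.mul (Real.continuous_cos.comp_continuousOn h.continuousOn_angle))
      (fun y hy => by simpa [cis] using (hasDerivWithinAt_plane.1 (h.hasDerivWithinAt y hy) 0)) hx
  · exact eq_primitive_of_hasDerivWithinAt
      (h.continuousOn.mul (Real.continuous_sin.comp_continuousOn h.continuousOn_angle))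
      (fun y hy => by simpa [cis] using (hasDerivWithinAt_plane.1 (h.hasDerivWithinAt y hy) 1)) hx

end HasPolarVelocity

/-! ### Curvatures of closed curves -/

/-- `g` is the curvature of a closed plane curve of unit length: the unit speed curve with tangent
angle `∫₀ᵗ g` returns to its starting point at time `1`. -/
structure IsClosedCurvature (g : ℝ → ℝ) : Prop where
  realL2 : RealL2 g
  cos : ∫ t in (0 : ℝ)..1, Real.cos (primitive 0 g t) = 0
  sin : ∫ t in (0 : ℝ)..1, Real.sin (primitive 0 g t) = 0

/-- Fenchel-type bound for closed curves with a corner: if the tangent angle varied by less than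
`π`, the tangent would stay in an open half plane and the curve could not close up. -/
theorem IsClosedCurvature.pi_le_integral_abs {g : ℝ → ℝ} (h : IsClosedCurvature g) :
    Real.pi ≤ ∫ t in (0 : ℝ)..1, |g t| := by
  by_contra! hlt
  set Θ := primitive 0 g with hΘ
  have hgi := h.realL2.intervalIntegrable
  have hc : ContinuousOn Θ (Icc 0 1) := continuousOn_primitive hgi 0
  obtain ⟨m, hm, hmin⟩ := isCompact_Icc.exists_isMinOn (nonempty_Icc.2 zero_le_one) hc
  obtain ⟨M, hM, hmax⟩ := isCompact_Icc.exists_isMaxOn (nonempty_Icc.2 zero_le_one) hc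
  have hsub : ∀ x ∈ Icc (0 : ℝ) 1, IntervalIntegrable g volume 0 x := fun x hx =>
    hgi.mono_set (by
      rw [uIcc_of_le hx.1, uIcc_of_le zero_le_one]; exact Icc_subset_Icc_right hx.2)
  have hosc : Θ M - Θ m < Real.pi := by
    have h1 : Θ M - Θ m = ∫ t in m..M, g t := by
      rw [hΘ, primitive, primitive, add_sub_add_left_eq_sub,
        intervalIntegral.integral_interval_sub_left (hsub M hM) (hsub m hm)]
    have h2 : |∫ t in m..M, g t| ≤ |(∫ t in m..M, |g t| : ℝ)| :=
      intervalIntegral.norm_integral_le_abs_integral_norm (f := g) (μ := volume)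
    have h3 : |(∫ t in m..M, |g t| : ℝ)| ≤ |(∫ t in (0 : ℝ)..1, |g t| : ℝ)| := by
      apply intervalIntegral.abs_integral_mono_interval
      · rw [uIoc_of_le zero_le_one]
        intro x hx
        rcases mem_uIoc.1 hx with h | h
        · exact ⟨hm.1.trans_lt h.1, h.2.trans hM.2⟩
        · exact ⟨hM.1.trans_lt h.1, h.2.trans hm.2⟩
      · exact Eventually.of_forall fun x => abs_nonneg _
      · exact hgi.abs
    have h4 : |(∫ t in (0 : ℝ)..1, |g t| : ℝ)| = ∫ t in (0 : ℝ)..1, |g t| :=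
      abs_of_nonneg (intervalIntegral.integral_nonneg zero_le_one fun x _ => abs_nonneg _)
    have := le_abs_self (∫ t in m..M, g t)
    linarith
  -- `c` is the middle of the range of the angle, so that `cos (Θ - c) > 0`.
  set c := (Θ m + Θ M) / 2 with hcdef
  have hcosi : IntervalIntegrable (fun t => Real.cos (Θ t)) volume 0 1 :=
    (Real.continuous_cos.comp_continuousOn hc).intervalIntegrable_unit
  have hsini : IntervalIntegrable (fun t => Real.sin (Θ t)) volume 0 1 :=
    (Real.continuous_sin.comp_continuousOn hc).intervalIntegrable_unit
  have hpos : 0 < ∫ t in (0 : ℝ)..1,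
      (Real.cos c * Real.cos (Θ t) + Real.sin c * Real.sin (Θ t)) := by
    apply intervalIntegral.intervalIntegral_pos_of_pos_on
      ((hcosi.const_mul _).add (hsini.const_mul _)) _ zero_lt_one
    intro t ht
    have h1 := isMinOn_iff.1 hmin t (Ioo_subset_Icc_self ht)
    have h2 := isMaxOn_iff.1 hmax t (Ioo_subset_Icc_self ht)
    rw [← Real.cos_sub]
    apply Real.cos_pos_of_mem_Ioo
    constructor <;> simp only [hcdef] <;> linarith
  rw [intervalIntegral.integral_add (hcosi.const_mul _) (hsini.const_mul _),
    intervalIntegral.integral_const_mul, intervalIntegral.integral_const_mul, h.cos, h.sin] at hpos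
  simp at hpos

/-! ### Reparametrization by arclength -/

/-- Change of variables on `[0,1]` along `s x = ∫₀ˣ w`, for a continuous positive density `w` of
total mass one; `ψ` is the inverse of `s`. The transformed functions need not be continuous. -/
theorem exists_change_of_variables {w : ℝ → ℝ} (hw : ContinuousOn w (Icc 0 1))
    (hpos : ∀ x, 0 < w x) (h1 : ∫ x in (0 : ℝ)..1, w x = 1) :
    ∃ s ψ : ℝ → ℝ, s 1 = 1 ∧ (∀ x ∈ Icc (0 : ℝ) 1, ψ (s x) = x) ∧
      (∀ (F : ℝ → ℝ), ∀ x ∈ Icc (0 : ℝ) 1,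
        ∫ t in (0 : ℝ)..s x, F t = ∫ u in (0 : ℝ)..x, w u * F (s u)) ∧
      ∀ F : ℝ → ℝ, IntervalIntegrable (fun u => w u * F (s u)) volume 0 1 →
        IntervalIntegrable F volume 0 1 := by
  set s := primitive 0 w with hs
  have hd : ∀ x ∈ Icc (0 : ℝ) 1, HasDerivWithinAt s (w x) (Icc 0 1) x :=
    fun x hx => hasDerivWithinAt_primitive hw 0 hx
  have hc : ContinuousOn s (Icc 0 1) := fun x hx => (hd x hx).continuousWithinAt
  have hmono : StrictMonoOn s (Icc 0 1) := by
    refine strictMonoOn_of_deriv_pos (convex_Icc 0 1) hc fun x hx => ?_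
    rw [interior_Icc] at hx
    rw [((hd x (Ioo_subset_Icc_self hx)).hasDerivAt (Icc_mem_nhds hx.1 hx.2)).deriv]
    exact hpos x
  have hs0 : s 0 = 0 := primitive_zero 0 w
  have hs1 : s 1 = 1 := by simp [hs, primitive, h1]
  have himg : ∀ x ∈ Icc (0 : ℝ) 1, s '' Icc 0 x = Icc 0 (s x) := by
    intro x hx
    have hsub : Icc 0 x ⊆ Icc (0 : ℝ) 1 := Icc_subset_Icc_right hx.2
    apply Subset.antisymm
    · rintro _ ⟨y, hy, rfl⟩
      refine ⟨?_, hmono.monotoneOn (hsub hy) hx hy.2⟩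
      rw [← hs0]
      exact hmono.monotoneOn (by simp) (hsub hy) hy.1
    · have := intermediate_value_Icc hx.1 (hc.mono hsub)
      rwa [hs0] at this
  have hs_nonneg : ∀ x ∈ Icc (0 : ℝ) 1, 0 ≤ s x := fun x hx => by
    rw [← hs0]; exact hmono.monotoneOn (by simp) hx hx.1
  refine ⟨s, Function.invFunOn s (Icc 0 1), hs1,
    fun x hx => hmono.injOn.leftInvOn_invFunOn hx, fun F x hx => ?_, fun F hF => ?_⟩
  · have hsub : Icc 0 x ⊆ Icc (0 : ℝ) 1 := Icc_subset_Icc_right hx.2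
    have := integral_image_eq_integral_abs_deriv_smul measurableSet_Icc
      (fun y hy => (hd y (hsub hy)).mono hsub) (hmono.injOn.mono hsub) F
    rw [himg x hx] at this
    rw [intervalIntegral.integral_of_le (hs_nonneg x hx), intervalIntegral.integral_of_le hx.1,
      ← integral_Icc_eq_integral_Ioc, ← integral_Icc_eq_integral_Ioc, this]
    simp [abs_of_pos (hpos _)]
  · have := integrableOn_image_iff_integrableOn_abs_deriv_smul measurableSet_Icc hd hmono.injOn F
    rw [himg 1 (by simp), hs1] at this
    rw [intervalIntegrable_iff_integrableOn_Icc_of_le zero_le_one, this]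
    rw [intervalIntegrable_iff_integrableOn_Icc_of_le zero_le_one] at hF
    simpa [abs_of_pos (hpos _)] using hF

theorem realL2_of_sq {g : ℝ → ℝ} (h1 : IntervalIntegrable g volume 0 1)
    (h2 : IntervalIntegrable (fun x => g x ^ 2) volume 0 1) : RealL2 g := by
  rw [intervalIntegrable_iff_integrableOn_Ioo_of_le zero_le_one] at h1 h2
  exact (memLp_two_iff_integrable_sq h1.aestronglyMeasurable).2 h2

theorem HasPolarVelocity.length_pos {η : ℝ → Plane} {σ κ : ℝ → ℝ} {θ : ℝ}
    (h : HasPolarVelocity η σ κ θ) : 0 < ∫ x in (0 : ℝ)..1, σ x :=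
  intervalIntegral.intervalIntegral_pos_of_pos h.intervalIntegrable_speed h.pos zero_lt_one

/-- Reparametrization of a closed curve by arclength, rescaled to unit length and rotated so that
the initial tangent angle is `0`. -/
theorem HasPolarVelocity.exists_isClosedCurvature {η : ℝ → Plane} {σ κ : ℝ → ℝ} {θ : ℝ}
    (h : HasPolarVelocity η σ κ θ) (hcl : η 0 = η 1) :
    ∃ g, IsClosedCurvature g ∧ (∫ t in (0 : ℝ)..1, |g t|) = ∫ x in (0 : ℝ)..1, |κ x| ∧
      (∫ t in (0 : ℝ)..1, g t ^ 2) =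
        (∫ x in (0 : ℝ)..1, σ x) * ∫ x in (0 : ℝ)..1, κ x ^ 2 / σ x := by
  set ℓ := ∫ x in (0 : ℝ)..1, σ x with hℓ
  have hℓ0 : 0 < ℓ := h.length_pos
  obtain ⟨s, ψ, hs1, hψ, hcov, hint⟩ := exists_change_of_variables (w := fun x => σ x / ℓ)
    (h.continuousOn.div_const ℓ) (fun x => div_pos (h.pos x) hℓ0)
    (by rw [intervalIntegral.integral_div, ← hℓ, div_self hℓ0.ne'])
  have hcov1 : ∀ F : ℝ → ℝ, ∫ t in (0 : ℝ)..1, F t = ∫ u in (0 : ℝ)..1, σ u / ℓ * F (s u) := by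
    intro F
    rw [← hcov F 1 (by simp), hs1]
  -- the curvature `κ / σ` as a function of arclength, scaled by `ℓ`
  set g : ℝ → ℝ := fun t => ℓ * κ (ψ t) / σ (ψ t) with hg
  have hgs : ∀ u ∈ Icc (0 : ℝ) 1, g (s u) = ℓ * κ u / σ u := fun u hu => by
    simp only [hg, hψ u hu]
  have hangle : ∀ u ∈ Icc (0 : ℝ) 1, primitive 0 g (s u) = primitive 0 κ u := by
    intro u hu
    rw [primitive, primitive, hcov g u hu]
    congr 1
    apply intervalIntegral.integral_congr
    intro v hv
    rw [uIcc_of_le hu.1] at hv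
    have := (h.pos v).ne'
    simp only
    rw [hgs v ⟨hv.1, hv.2.trans hu.2⟩]
    field_simp
  -- equality of integrands on `[0,1]` after the change of variables
  have hcongr : ∀ {F G : ℝ → ℝ}, (∀ u ∈ Icc (0 : ℝ) 1, σ u / ℓ * F (s u) = G u) →
      ∫ t in (0 : ℝ)..1, F t = ∫ u in (0 : ℝ)..1, G u := by
    intro F G hFG
    rw [hcov1]
    apply intervalIntegral.integral_congr
    intro u hu
    rw [uIcc_of_le zero_le_one] at hu
    exact hFG u hu
  have hintegrable : ∀ {F G : ℝ → ℝ}, (∀ u ∈ Icc (0 : ℝ) 1, σ u / ℓ * F (s u) = G u) →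
      IntervalIntegrable G volume 0 1 → IntervalIntegrable F volume 0 1 := by
    intro F G hFG hG
    refine hint F (hG.congr fun u hu => ?_)
    rw [uIoc_of_le zero_le_one] at hu
    exact (hFG u (Ioc_subset_Icc_self hu)).symm
  have hsq : ∀ u ∈ Icc (0 : ℝ) 1, σ u / ℓ * g (s u) ^ 2 = ℓ * (κ u ^ 2 / σ u) := by
    intro u hu
    have := (h.pos u).ne'
    rw [hgs u hu]
    field_simp
  have hclose := h.eq_add_integral (x := 1) (by simp)
  rw [hcl] at hclose
  have hcos0 : ∫ t in (0 : ℝ)..1, σ t * Real.cos (primitive θ κ t) = 0 := by linarith [hclose.1]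
  have hsin0 : ∫ t in (0 : ℝ)..1, σ t * Real.sin (primitive θ κ t) = 0 := by linarith [hclose.2]
  have hci : IntervalIntegrable (fun t => σ t * Real.cos (primitive θ κ t)) volume 0 1 :=
    (h.continuousOn.mul
      (Real.continuous_cos.comp_continuousOn h.continuousOn_angle)).intervalIntegrable_unit
  have hsi : IntervalIntegrable (fun t => σ t * Real.sin (primitive θ κ t)) volume 0 1 :=
    (h.continuousOn.mul
      (Real.continuous_sin.comp_continuousOn h.continuousOn_angle)).intervalIntegrable_unit
  have hrot : ∀ u, primitive 0 κ u = primitive θ κ u - θ := fun u => by simp [primitive]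
  refine ⟨g, ⟨realL2_of_sq ?_ ?_, ?_, ?_⟩, ?_, ?_⟩
  · refine hintegrable (G := κ) (fun u hu => ?_) h.realL2.intervalIntegrable
    have := (h.pos u).ne'
    rw [hgs u hu]
    field_simp
  · exact hintegrable hsq (h.intervalIntegrable_sq_div.const_mul ℓ)
  · rw [hcongr (G := fun u => Real.cos θ / ℓ * (σ u * Real.cos (primitive θ κ u)) +
      Real.sin θ / ℓ * (σ u * Real.sin (primitive θ κ u))) (fun u hu => by
        rw [hangle u hu, hrot, Real.cos_sub]; ring),
      intervalIntegral.integral_add (hci.const_mul _) (hsi.const_mul _),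
      intervalIntegral.integral_const_mul, intervalIntegral.integral_const_mul, hcos0, hsin0]
    simp
  · rw [hcongr (G := fun u => Real.cos θ / ℓ * (σ u * Real.sin (primitive θ κ u)) -
      Real.sin θ / ℓ * (σ u * Real.cos (primitive θ κ u))) (fun u hu => by
        rw [hangle u hu, hrot, Real.sin_sub]; ring),
      intervalIntegral.integral_sub (hsi.const_mul _) (hci.const_mul _),
      intervalIntegral.integral_const_mul, intervalIntegral.integral_const_mul, hcos0, hsin0]
    simp
  · refine hcongr fun u hu => ?_
    have := (h.pos u).ne'
    rw [hgs u hu, abs_div, abs_mul, abs_of_pos hℓ0, abs_of_pos (h.pos u)]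
    field_simp
  · rw [hcongr hsq, intervalIntegral.integral_const_mul]

/-! ### Minimization by the direct method -/

/-- Bounded sequences in a separable Hilbert space have weakly convergent subsequences. -/
theorem exists_weakly_convergent_subseq {H : Type*} [NormedAddCommGroup H] [InnerProductSpace ℝ H]
    [CompleteSpace H] [TopologicalSpace.SeparableSpace H] {x : ℕ → H} {R : ℝ}
    (hx : ∀ n, ‖x n‖ ≤ R) :
    ∃ y : H, ∃ φ : ℕ → ℕ, StrictMono φ ∧
      ∀ h : H, Tendsto (fun n => inner ℝ (x (φ n)) h) atTop (𝓝 (inner ℝ y h)) := by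
  obtain ⟨ℓ, -, φ, hφ, hℓ⟩ := WeakDual.isSeqCompact_closedBall ℝ H 0 R
    (x := fun n => StrongDual.toWeakDual (InnerProductSpace.toDual ℝ H (x n))) (fun n => by
      simpa using hx n)
  refine ⟨(InnerProductSpace.toDual ℝ H).symm (WeakDual.toStrongDual ℓ), φ, hφ, fun h => ?_⟩
  rw [InnerProductSpace.toDual_symm_apply]
  have := (WeakDual.eval_continuous (𝕜 := ℝ) h).continuousAt.tendsto.comp hℓ
  exact this

/-- The Hilbert space `L²(0,1)`. -/
abbrev UnitL2 : Type := Lp ℝ 2 (volume.restrict (Ioo (0 : ℝ) 1))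

theorem inner_toLp {f g : ℝ → ℝ} (hf : RealL2 f) (hg : RealL2 g) :
    inner ℝ (hf.toLp f : UnitL2) (hg.toLp g) = ∫ x in (0 : ℝ)..1, f x * g x := by
  rw [L2.inner_def, ← integral_Ioo_eq]
  apply integral_congr_ae
  filter_upwards [hf.coeFn_toLp, hg.coeFn_toLp] with x h1 h2
  rw [h1, h2]
  exact mul_comm _ _

theorem realL2_indicator (x : ℝ) : RealL2 ((Ioc 0 x).indicator fun _ => (1 : ℝ)) :=
  (memLp_const 1).indicator measurableSet_Ioc

theorem integral_mul_indicator (f : ℝ → ℝ) {x : ℝ} (hx : x ∈ Icc (0 : ℝ) 1) :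
    ∫ t in (0 : ℝ)..1, f t * (Ioc 0 x).indicator (fun _ => (1 : ℝ)) t = primitive 0 f x := by
  have : ∀ t, f t * (Ioc 0 x).indicator (fun _ => (1 : ℝ)) t = (Ioc 0 x).indicator f t := by
    intro t
    by_cases h : t ∈ Ioc 0 x <;> simp [h]
  simp_rw [this]
  rw [intervalIntegral.integral_of_le zero_le_one, setIntegral_indicator measurableSet_Ioc,
    inter_eq_right.2 (Ioc_subset_Ioc_right hx.2), primitive, zero_add,
    intervalIntegral.integral_of_le hx.1]

/-- The circle of unit length. -/
theorem isClosedCurvature_circle : IsClosedCurvature fun _ => 2 * Real.pi := by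
  have h : ∀ t, primitive 0 (fun _ => 2 * Real.pi) t = 2 * Real.pi * t := fun t => by
    simp [primitive]
    ring
  have hpi : (2 * Real.pi) ≠ 0 := by positivity
  refine ⟨continuousOn_const.realL2, ?_, ?_⟩
  · simp_rw [h]
    rw [intervalIntegral.integral_comp_mul_left Real.cos hpi]
    simp
  · simp_rw [h]
    rw [intervalIntegral.integral_comp_mul_left Real.sin hpi]
    simp

/-- The direct method: `∫ g²` attains its minimum among the curvatures of closed curves. Weak `L²`
convergence of `gₙ` gives pointwise convergence of the tangent angles `∫₀ᵗ gₙ`, so the closing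
condition passes to the limit by dominated convergence. -/
theorem exists_isClosedCurvature_minimizing : ∃ g, IsClosedCurvature g ∧
    ∀ f, IsClosedCurvature f → ∫ t in (0 : ℝ)..1, g t ^ 2 ≤ ∫ t in (0 : ℝ)..1, f t ^ 2 := by
  set S : Set ℝ := {e | ∃ f, IsClosedCurvature f ∧ ∫ t in (0 : ℝ)..1, f t ^ 2 = e} with hS
  have hne : S.Nonempty := ⟨_, _, isClosedCurvature_circle, rfl⟩
  have hbdd : BddBelow S := by
    refine ⟨0, ?_⟩
    rintro _ ⟨f, -, rfl⟩
    exact intervalIntegral.integral_nonneg zero_le_one fun x _ => sq_nonneg _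
  obtain ⟨e, hanti, hlim, he⟩ := exists_seq_tendsto_sInf hne hbdd
  choose f hf hfe using he
  have hnorm : ∀ n, ‖((hf n).realL2.toLp (f n) : UnitL2)‖ ^ 2 = e n := by
    intro n
    rw [← real_inner_self_eq_norm_sq, inner_toLp, ← hfe n]
    simp_rw [sq]
  have : Fact ((2 : ENNReal) ≠ ⊤) := ⟨ENNReal.ofNat_ne_top⟩
  obtain ⟨y, φ, hφ, hy⟩ := exists_weakly_convergent_subseq
    (x := fun n => ((hf n).realL2.toLp (f n) : UnitL2)) (R := √(e 0)) (fun n => by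
      apply Real.le_sqrt_of_sq_le
      rw [hnorm]
      exact hanti (Nat.zero_le n))
  have hg : RealL2 y := Lp.memLp y
  have hgy : (hg.toLp y : UnitL2) = y := Lp.toLp_coeFn y hg
  have hptw : ∀ x ∈ Icc (0 : ℝ) 1,
      Tendsto (fun n => primitive 0 (f (φ n)) x) atTop (𝓝 (primitive 0 y x)) := by
    intro x hx
    have := hy ((realL2_indicator x).toLp _)
    rw [← hgy, inner_toLp, integral_mul_indicator _ hx] at this
    simpa only [inner_toLp, integral_mul_indicator _ hx] using this
  have hlimit : ∀ F : ℝ → ℝ, Continuous F → (∀ x, |F x| ≤ 1) →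
      (∀ n, ∫ t in (0 : ℝ)..1, F (primitive 0 (f n) t) = 0) →
      ∫ t in (0 : ℝ)..1, F (primitive 0 y t) = 0 := by
    intro F hF hF1 h0
    have := intervalIntegral.tendsto_integral_filter_of_dominated_convergence
      (μ := volume) (a := 0) (b := 1) (l := atTop)
      (F := fun n t => F (primitive 0 (f (φ n)) t)) (f := fun t => F (primitive 0 y t))
      (fun _ => 1)
      (Eventually.of_forall fun n => by
        refine (ContinuousOn.aestronglyMeasurable (s := Icc 0 1) ?_ measurableSet_Icc).mono_measure
          (Measure.restrict_mono (by rw [uIoc_of_le zero_le_one]; exact Ioc_subset_Icc_self) le_rfl)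
        exact hF.comp_continuousOn (continuousOn_primitive (hf _).realL2.intervalIntegrable 0))
      (Eventually.of_forall fun n => Eventually.of_forall fun t _ => hF1 _)
      intervalIntegrable_const
      (Eventually.of_forall fun t ht => by
        rw [uIoc_of_le zero_le_one] at ht
        exact (hF.tendsto _).comp (hptw t (Ioc_subset_Icc_self ht)))
    simp_rw [h0] at this
    exact tendsto_nhds_unique this tendsto_const_nhds
  refine ⟨y, ⟨hg, hlimit _ Real.continuous_cos Real.abs_cos_le_one fun n => (hf n).cos,
    hlimit _ Real.continuous_sin Real.abs_sin_le_one fun n => (hf n).sin⟩, fun k hk => ?_⟩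
  have hySq : ∫ t in (0 : ℝ)..1, y t ^ 2 = ‖y‖ ^ 2 := by
    rw [← real_inner_self_eq_norm_sq, ← hgy, inner_toLp]
    simp_rw [sq]
    rw [hgy]
  -- weak lower semicontinuity of the norm, from `2⟪gₙ, y⟫ ≤ ‖gₙ‖² + ‖y‖²`
  have hle : ‖y‖ ^ 2 ≤ (sInf S + ‖y‖ ^ 2) / 2 := by
    have h1 := hy y
    rw [real_inner_self_eq_norm_sq] at h1
    have h2 : Tendsto (fun n => (e (φ n) + ‖y‖ ^ 2) / 2) atTop (𝓝 ((sInf S + ‖y‖ ^ 2) / 2)) :=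
      ((hlim.comp hφ.tendsto_atTop).add_const _).div_const 2
    refine le_of_tendsto_of_tendsto' h1 h2 fun n => ?_
    have h3 := real_inner_le_norm ((hf (φ n)).realL2.toLp (f (φ n)) : UnitL2) y
    rw [← hnorm (φ n)]
    nlinarith [sq_nonneg (‖((hf (φ n)).realL2.toLp (f (φ n)) : UnitL2)‖ - ‖y‖)]
  rw [hySq]
  have := csInf_le hbdd ⟨k, hk, rfl⟩
  linarith

/-! ### Drops -/

theorem eq_primitive_of_ae_hasDerivAt {f p : ℝ → ℝ} (hf : AbsolutelyContinuousOnInterval f 0 1)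
    (hp : IntervalIntegrable p volume 0 1)
    (h : ∀ᵐ x, x ∈ Icc (0 : ℝ) 1 → HasDerivAt f (p x) x) {x : ℝ} (hx : x ∈ Icc (0 : ℝ) 1) :
    f x = primitive (f 0) p x := by
  have := eq_of_ae_hasDerivAt_zero (f := fun x => f x - primitive (f 0) p x)
    (hf.fun_sub (absolutelyContinuousOnInterval_primitive hp _)) (by
      filter_upwards [h, ae_hasDerivAt_primitive hp (f 0)] with y h1 h2 hy
      exact ((h1 hy).fun_sub (h2 hy)).congr_deriv (sub_self _)) hx
  simp only [primitive_zero, sub_self] at this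
  linarith

theorem HasPolarVelocity.isH2_of_const {η : ℝ → Plane} {ℓ : ℝ} {g : ℝ → ℝ} {θ : ℝ}
    (h : HasPolarVelocity η (fun _ => ℓ) g θ) : IsH2 η := by
  have hA := absolutelyContinuousOnInterval_primitive h.realL2.intervalIntegrable θ
  have hd := ae_hasDerivAt_primitive h.realL2.intervalIntegrable θ
  set Θ := primitive θ g with hΘ
  have hs : RealL2 fun x => -ℓ * Real.sin (Θ x) * g x := h.realL2.continuousOn_mul
    (continuousOn_const.mul (Real.continuous_sin.comp_continuousOn h.continuousOn_angle))
  have hc : RealL2 fun x => ℓ * Real.cos (Θ x) * g x := h.realL2.continuousOn_mul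
    (continuousOn_const.mul (Real.continuous_cos.comp_continuousOn h.continuousOn_angle))
  refine isH2_of_hasDerivWithinAt (c := ![ℓ * Real.cos (Θ 0), ℓ * Real.sin (Θ 0)])
    (p := ![fun x => -ℓ * Real.sin (Θ x) * g x, fun x => ℓ * Real.cos (Θ x) * g x])
    (fun i => by fin_cases i <;> assumption) fun x hx i => ?_
  have hder := hasDerivWithinAt_plane.1 (h.hasDerivWithinAt x hx) i
  fin_cases i
  · refine hder.congr_deriv ?_
    refine Eq.trans ?_ (eq_primitive_of_ae_hasDerivAt (f := fun x => ℓ * Real.cos (Θ x))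
      ((Real.contDiff_cos.comp_absolutelyContinuousOnInterval hA).const_mul ℓ)
      hs.intervalIntegrable ?_ hx)
    · simp [cis, hΘ]
    · filter_upwards [hd] with y hy hy'
      exact ((hy hy').cos.const_mul ℓ).congr_deriv (by ring)
  · refine hder.congr_deriv ?_
    refine Eq.trans ?_ (eq_primitive_of_ae_hasDerivAt (f := fun x => ℓ * Real.sin (Θ x))
      ((Real.contDiff_sin.comp_absolutelyContinuousOnInterval hA).const_mul ℓ)
      hc.intervalIntegrable ?_ hx)
    · simp [cis, hΘ]
    · filter_upwards [hd] with y hy hy'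
      exact ((hy hy').sin.const_mul ℓ).congr_deriv (by ring)

/-- Every curvature of a closed curve of unit length is realized, at any scale `ℓ`, by a drop of
length `ℓ` with constant speed. -/
theorem IsClosedCurvature.exists_isDrop {g : ℝ → ℝ} (h : IsClosedCurvature g) {ℓ : ℝ}
    (hℓ : 0 < ℓ) : ∃ γ, IsDrop γ ∧ HasPolarVelocity γ (fun _ => ℓ) g 0 := by
  have hΘ : ContinuousOn (primitive 0 g) (Icc 0 1) :=
    continuousOn_primitive h.realL2.intervalIntegrable 0
  have hγ : HasPolarVelocity (fun x => !₂[primitive 0 (fun t => ℓ * Real.cos (primitive 0 g t)) x,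
      primitive 0 (fun t => ℓ * Real.sin (primitive 0 g t)) x]) (fun _ => ℓ) g 0 := by
    refine ⟨continuousOn_const, fun _ => hℓ, h.realL2, fun x hx => ?_⟩
    rw [hasDerivWithinAt_plane]
    intro i
    fin_cases i
    · simpa [cis] using hasDerivWithinAt_primitive (g := fun t => ℓ * Real.cos (primitive 0 g t))
        (continuousOn_const.mul (Real.continuous_cos.comp_continuousOn hΘ)) 0 hx
    · simpa [cis] using hasDerivWithinAt_primitive (g := fun t => ℓ * Real.sin (primitive 0 g t))
        (continuousOn_const.mul (Real.continuous_sin.comp_continuousOn hΘ)) 0 hx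
  refine ⟨_, ⟨hγ.isH2_of_const, hγ.isRegular, ?_⟩, hγ⟩
  have key : ∀ F : ℝ → ℝ, ∫ t in (0 : ℝ)..1, F t = 0 → primitive 0 (fun t => ℓ * F t) 1 = 0 := by
    intro F hF
    rw [primitive, intervalIntegral.integral_const_mul, hF, mul_zero, add_zero]
  simp only [primitive_zero, key _ h.cos, key _ h.sin]

theorem RealL2.sq_integral_abs_le {g : ℝ → ℝ} (h : RealL2 g) :
    (∫ t in (0 : ℝ)..1, |g t|) ^ 2 ≤ ∫ t in (0 : ℝ)..1, g t ^ 2 := by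
  set a := ∫ t in (0 : ℝ)..1, |g t| with ha
  have h1 : IntervalIntegrable (fun t => g t ^ 2) volume 0 1 := by
    simpa only [sq] using h.intervalIntegrable_mul h
  have h2 : IntervalIntegrable (fun t => |g t|) volume 0 1 := h.intervalIntegrable.abs
  -- the variance of `|g|` is nonnegative
  have h3 : 0 ≤ ∫ t in (0 : ℝ)..1, (g t ^ 2 - 2 * a * |g t| + a ^ 2) := by
    refine intervalIntegral.integral_nonneg zero_le_one fun t _ => ?_
    rw [← sq_abs]
    nlinarith [sq_nonneg (|g t| - a)]
  rw [intervalIntegral.integral_add (h1.sub (h2.const_mul _)) intervalIntegrable_const,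
    intervalIntegral.integral_sub h1 (h2.const_mul _), intervalIntegral.integral_const_mul,
    intervalIntegral.integral_const, ← ha] at h3
  simp only [sub_zero, one_smul] at h3
  nlinarith

theorem IsClosedCurvature.sq_pi_le {g : ℝ → ℝ} (h : IsClosedCurvature g) :
    Real.pi ^ 2 ≤ ∫ t in (0 : ℝ)..1, g t ^ 2 :=
  (pow_le_pow_left₀ Real.pi_pos.le h.pi_le_integral_abs 2).trans h.realL2.sq_integral_abs_le

/-- The arclength data of a drop: its length `ℓ`, its bending energy `K = ∫ k² ds`, and the
curvature `g` of its rescaling to unit length. -/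
theorem IsDrop.exists_isClosedCurvature {η : ℝ → Plane} (h : IsDrop η) :
    ∃ g K, IsClosedCurvature g ∧ 0 ≤ K ∧ 0 < length η ∧ energy η = K + length η ∧
      (∫ t in (0 : ℝ)..1, g t ^ 2) = length η * K ∧
      (∫ t in (0 : ℝ)..1, |g t|) = arcIntegral η fun x => |curvature η x| := by
  obtain ⟨σ, κ, θ, hp⟩ := h.1.exists_hasPolarVelocity h.2.1
  obtain ⟨g, hg, habs, hsq⟩ := hp.exists_isClosedCurvature h.2.2
  refine ⟨g, ∫ x in (0 : ℝ)..1, κ x ^ 2 / σ x, hg, ?_, ?_, ?_, ?_, ?_⟩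
  · exact intervalIntegral.integral_nonneg zero_le_one fun x _ =>
      div_nonneg (sq_nonneg _) (hp.pos x).le
  · rw [hp.length_eq]
    exact hp.length_pos
  · rw [hp.energy_eq, hp.length_eq]
  · rw [hsq, hp.length_eq]
  · rw [habs, hp.arcIntegral_abs_curvature]

theorem IsDrop.pi_le {η : ℝ → Plane} (h : IsDrop η) :
    Real.pi ≤ arcIntegral η fun x => |curvature η x| := by
  obtain ⟨g, K, hg, -, -, -, -, habs⟩ := h.exists_isClosedCurvature
  rw [← habs]
  exact hg.pi_le_integral_abs

/-- A bound from below for the length of a drop in terms of its energy. -/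
theorem IsDrop.sq_pi_le_energy_mul_length {η : ℝ → Plane} (h : IsDrop η) :
    Real.pi ^ 2 ≤ energy η * length η := by
  obtain ⟨g, K, hg, hK, hL, hE, hsq, -⟩ := h.exists_isClosedCurvature
  have := hg.sq_pi_le
  rw [hE]
  nlinarith

theorem exists_isDrop_energy_le : ∃ γ, IsDrop γ ∧ ∀ η, IsDrop η → energy γ ≤ energy η := by
  obtain ⟨g, hg, hmin⟩ := exists_isClosedCurvature_minimizing
  set e := ∫ t in (0 : ℝ)..1, g t ^ 2 with he
  have he0 : 0 < e := lt_of_lt_of_le (by positivity) hg.sq_pi_le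
  have hs0 : 0 < √e := Real.sqrt_pos.2 he0
  have hsq : √e ^ 2 = e := Real.sq_sqrt he0.le
  -- `√e` is the minimizer of `ℓ ↦ e / ℓ + ℓ`
  obtain ⟨γ, hγ, hp⟩ := hg.exists_isDrop hs0
  refine ⟨γ, hγ, fun η hη => ?_⟩
  have hEγ : energy γ = 2 * √e := by
    rw [hp.energy_eq, intervalIntegral.integral_div, ← he, intervalIntegral.integral_const]
    simp only [sub_zero, one_smul]
    nth_rewrite 1 [← hsq]
    field_simp
    ring
  obtain ⟨f, K, hf, hK, hL, hE, hf2, -⟩ := hη.exists_isClosedCurvature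
  have h1 := hmin f hf
  rw [hf2] at h1
  rw [hEγ, hE]
  refine le_of_sq_le_sq ?_ (by positivity)
  nlinarith [sq_nonneg (K - length η)]

end ElasticCurve

end

theorem mainTheorem8 :
    -- the infimum is attained (and is a genuine lower bound, not a junk value)
    (∃ γ : ℝ → ElasticCurve.Plane, ElasticCurve.IsDrop γ ∧
      ElasticCurve.energy γ = ElasticCurve.infEnergy ∧
      ∀ η : ℝ → ElasticCurve.Plane, ElasticCurve.IsDrop η →
        ElasticCurve.energy γ ≤ ElasticCurve.energy η) ∧
    -- every drop has total absolute curvature at least `π`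
    (∀ η : ℝ → ElasticCurve.Plane, ElasticCurve.IsDrop η →
      Real.pi ≤ ElasticCurve.arcIntegral η (fun x => |ElasticCurve.curvature η x|)) ∧
    -- lengths along a minimizing sequence stay bounded away from zero
    (∀ γ : ℕ → ℝ → ElasticCurve.Plane, (∀ n, ElasticCurve.IsDrop (γ n)) →
      Tendsto (fun n => ElasticCurve.energy (γ n)) atTop (𝓝 ElasticCurve.infEnergy) →
      ∃ c : ℝ, 0 < c ∧ ∀ n, c ≤ ElasticCurve.length (γ n)) := by
  refine ⟨?_, fun η hη => hη.pi_le, fun γ hγ hlim => ?_⟩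
  · obtain ⟨γ, hγ, hmin⟩ := ElasticCurve.exists_isDrop_energy_le
    have hleast : IsLeast {e : ℝ | ∃ η, ElasticCurve.IsDrop η ∧ ElasticCurve.energy η = e}
        (ElasticCurve.energy γ) := by
      refine ⟨⟨γ, hγ, rfl⟩, ?_⟩
      rintro _ ⟨η, hη, rfl⟩
      exact hmin η hη
    exact ⟨γ, hγ, hleast.csInf_eq.symm, hmin⟩
  · obtain ⟨B, hB⟩ := hlim.bddAbove_range
    have hpi : 0 < Real.pi ^ 2 := by positivity
    have hbound : ∀ n, Real.pi ^ 2 ≤ B * ElasticCurve.length (γ n) := fun n => by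
      obtain ⟨-, -, -, -, hL, -⟩ := (hγ n).exists_isClosedCurvature
      exact (hγ n).sq_pi_le_energy_mul_length.trans
        (mul_le_mul_of_nonneg_right (hB ⟨n, rfl⟩) hL.le)
    have hB0 : 0 < B := by
      obtain ⟨-, -, -, -, hL, -⟩ := (hγ 0).exists_isClosedCurvature
      exact pos_of_mul_pos_left (hpi.trans_le (hbound 0)) hL.le
    exact ⟨Real.pi ^ 2 / B, div_pos hpi hB0, fun n => (div_le_iff₀' hB0).2 (hbound n)⟩
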